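/- For $a\in\mathbb C$ let $(a)_n=a(a+1)\cdots(a+n-1)$. For $k\in\mathbb N_0$ and $\tau,x\in\mathbb C$ let $$C_k^{\tau}(x)=\sum_{j=0}^{\lfloor k/2\rfloor}\frac{(-1)^j(\tau)_{k-j}}{j!\,(k-2j)!}(2x)^{k-2j}$$ be the Gegenbauer polynomial, and let $g_n(\sigma)$ be the Mittag-Leffler polynomials: $g_0(\sigma)=1$ and $g_n(\sigma)=2\sigma\,F(1-n,1-\sigma;2;2)$ for $n\ge1$, where $F$ is the Gauss hypergeometric function (here a finite sum). Let $k\in\mathbb N_0$ and $\lambda\in\mathbb C$. 1. Suppose that $k+2\lambda+j\ne0$ for $j=0,\dots,k-1$ (that is, no denominator below vanishes). Then for every $x\in\mathbb C\setminus\{0,1\}$, $$\frac{C_k^{\lambda}(x)}{2^k(x-1)^k}=\sum_{m=0}^{k}\frac{g_{k-m}\left(k+\lambda-\frac12\right)(\lambda)_{k-m}}{(k+2\lambda)_{k-m}}\,\frac{C_m^{k-m+\lambda}\left(\frac1x\right)}{2^m\left(1-\frac1x\right)^m},$$ $$\frac{C_k^{\lambda}\left(\frac1x\right)}{2^k\left(1-\frac1x\right)^k}=\sum_{m=0}^{k}\frac{g_{k-m}\left(\frac12-k-\lambda\right)(\lambda)_{k-m}}{(k+2\lambda)_{k-m}}\,\frac{C_m^{k-m+\lambda}(x)}{2^m(x-1)^m}.$$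 These sums are mutually inverse: writing $a_{k,m}(\lambda)=g_{k-m}(k+\lambda-\frac12)\frac{(\lambda)_{k-m}}{(k+2\lambda)_{k-m}}$ and $b_{k,m}(\lambda)=g_{k-m}(\frac12-k-\lambda)\frac{(\lambda)_{k-m}}{(k+2\lambda)_{k-m}}$, one has for $0\le n\le k$ $$\sum_{m=n}^{k}a_{k,m}(\lambda)\,b_{m,n}(k-m+\lambda)=\sum_{m=n}^{k}b_{k,m}(\lambda)\,a_{m,n}(k-m+\lambda)=\delta_{n,k}.$$ 2. For every $\lambda\in\mathbb C$, including the values excluded in 1, and every $x\in\mathbb C\setminus\{0,1\}$, the two right-hand sides of the displayed identities, taken at a parameter $z\ne\lambda$ instead of $\lambda$, tend as $z\to\lambda$ to the respective left-hand sides at $\lambda$. -/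

import Mathlib

open Filter Topology

noncomputable section

/-- The Pochhammer symbol `(a)_n = a (a + 1) ⋯ (a + n - 1)`. -/
def poch (a : ℂ) (n : ℕ) : ℂ := (ascPochhammer ℂ n).eval a

/-- The Gegenbauer polynomial
`C_k^τ(x) = (1/Γ(τ)) ∑_{j=0}^{⌊k/2⌋} (-1)^j Γ(k-j+τ) / (j! (k-2j)!) (2x)^{k-2j}`,
where `Γ(k-j+τ)/Γ(τ)` is the Pochhammer symbol `(τ)_{k-j}`; in this form it is defined
for every complex parameter `τ`. -/
def gegenbauerC (k : ℕ) (τ x : ℂ) : ℂ :=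
  ∑ j ∈ Finset.range (k / 2 + 1),
    (-1) ^ j * poch τ (k - j) / ((j.factorial : ℂ) * ((k - 2 * j).factorial : ℂ)) *
      (2 * x) ^ (k - 2 * j)

/-- The Mittag-Leffler polynomial: `g_0(σ) = 1` and, for `n ≥ 1`,
`g_n(σ) = 2σ F(1-n, 1-σ; 2; 2)` (a terminating Gauss hypergeometric series). -/
def mittagLefflerG (n : ℕ) (σ : ℂ) : ℂ :=
  if n = 0 then 1 else 2 * σ * ordinaryHypergeometric (1 - (n : ℂ)) (1 - σ) 2 (2 : ℂ)

/-- The coefficient `g_{k-m}(k+λ-1/2) (λ)_{k-m} / (k+2λ)_{k-m}` (used for `m ≤ k`). -/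
def coeffFwd (k m : ℕ) (lam : ℂ) : ℂ :=
  mittagLefflerG (k - m) ((k : ℂ) + lam - 1 / 2) * poch lam (k - m) /
    poch ((k : ℂ) + 2 * lam) (k - m)

/-- The coefficient `g_{k-m}(1/2-k-λ) (λ)_{k-m} / (k+2λ)_{k-m}` (used for `m ≤ k`). -/
def coeffBwd (k m : ℕ) (lam : ℂ) : ℂ :=
  mittagLefflerG (k - m) (1 / 2 - (k : ℂ) - lam) * poch lam (k - m) /
    poch ((k : ℂ) + 2 * lam) (k - m)

/-- `C_m^τ(x) / (2^m (x-1)^m)`. -/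
def normC (m : ℕ) (τ x : ℂ) : ℂ :=
  gegenbauerC m τ x / (2 ^ m * (x - 1) ^ m)

/-- `C_m^τ(1/x) / (2^m (1-1/x)^m)`. -/
def normCRecip (m : ℕ) (τ x : ℂ) : ℂ :=
  gegenbauerC m τ (1 / x) / (2 ^ m * (1 - 1 / x) ^ m)

end

/-! Expanding `C_k^τ` at `1` (`gegenbauerC_eq_sum_sub_one`) makes `normC k τ x` a polynomial in `w =
1/(2(x-1))`. Replacing `x` by `1/x` is the involution `w ↦ -(w + 1/2)`, so the first two identities
are one polynomial identity, `sum_normCoeff_mul_pow`, read at `-(w + 1/2)` and at `w`; a parity sign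
turns `coeffFwd` into `coeffBwd`.

Comparing coefficients (`sum_normCoeff_eq`) and applying reflection and duplication of Pochhammer
symbols reduces it to `sum_mittagLefflerG_mul_poch`, a consequence of the generating function `∑
g_n(s) X^n = ((1+X)/(1-X))^s`.

The sums are inverse because the series for `s` and `-s` multiply to `1`, while the Pochhammer
quotients telescope and `s = k + λ - 1/2` is unchanged under `(k, λ) ↦ (m, k-m+λ)`. The limits hold
because the left sides are continuous in `λ` and the excluded parameters are finite in number. -/

lemma poch_zero (a : ℂ) : poch a 0 = 1 := by simp [poch]

lemma poch_succ (a : ℂ) (n : ℕ) : poch a (n + 1) = poch a n * (a + n) := by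
  simp [poch, ascPochhammer_succ_eval]

lemma poch_add (a : ℂ) (m n : ℕ) : poch a (m + n) = poch a m * poch (a + m) n := by
  induction n with
  | zero => simp [poch_zero]
  | succ n ih => rw [← add_assoc, poch_succ, ih, poch_succ]; push_cast; ring

lemma poch_succ_left (a : ℂ) (n : ℕ) : poch a (n + 1) = a * poch (a + 1) n := by
  rw [add_comm, poch_add, poch_succ, poch_zero]; simp

lemma poch_reflect (a : ℂ) (n : ℕ) : poch (1 - a - n) n = (-1) ^ n * poch a n := by
  induction n generalizing a with
  | zero => simp [poch_zero]
  | succ n ih =>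
    rw [poch_succ_left, poch_succ, show 1 - a - ((n + 1 : ℕ) : ℂ) + 1 = 1 - a - n by
      push_cast; ring, ih]
    push_cast; ring

lemma poch_two_mul (a : ℂ) (n : ℕ) :
    poch (2 * a) (2 * n) = 4 ^ n * poch a n * poch (a + 1 / 2) n := by
  induction n with
  | zero => simp [poch_zero]
  | succ n ih =>
    rw [show 2 * (n + 1) = 2 * n + 1 + 1 by ring, poch_succ, poch_succ, ih, poch_succ, poch_succ]
    push_cast; ring

lemma poch_ne_zero {a : ℂ} {n : ℕ} (h : ∀ j < n, a + j ≠ 0) : poch a n ≠ 0 := by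
  induction n with
  | zero => simp [poch_zero]
  | succ n ih =>
    rw [poch_succ]
    exact mul_ne_zero (ih fun j hj => h j (by omega)) (h n (by omega))

lemma factorial_mul_poch (m n : ℕ) :
    (m.factorial : ℂ) * poch ((m : ℂ) + 1) n = ((m + n).factorial : ℂ) := by
  induction n with
  | zero => simp [poch_zero]
  | succ n ih =>
    rw [poch_succ, ← mul_assoc, ih, ← add_assoc, Nat.factorial_succ]; push_cast; ring

lemma natCast_add_choose_mul (m n : ℕ) :
    ((m + n).choose m : ℂ) * m.factorial * n.factorial = (m + n).factorial := by
  have h := Nat.add_choose_mul_factorial_mul_factorial m n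
  rw [← Nat.choose_symm_add] at h
  exact_mod_cast h

lemma poch_neg_natCast (n i : ℕ) :
    poch (-(n : ℂ)) i = (-1) ^ i * (i.factorial * n.choose i : ℕ) := by
  rw [← Nat.descFactorial_eq_factorial_mul_choose, poch,
    ascPochhammer_eval_neg_eq_descPochhammer, descPochhammer_eval_eq_descFactorial]

lemma continuous_poch (n : ℕ) : Continuous fun a => poch a n :=
  (ascPochhammer ℂ n).continuous

/-- A function on `ℂ` given by evaluating a polynomial. -/
def IsPolyFun (f : ℂ → ℂ) : Prop := ∃ P : Polynomial ℂ, ∀ a, f a = P.eval a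

namespace IsPolyFun

lemma const (c : ℂ) : IsPolyFun fun _ => c := ⟨Polynomial.C c, by simp⟩

lemma id : IsPolyFun fun a => a := ⟨Polynomial.X, by simp⟩

lemma add {f g : ℂ → ℂ} (hf : IsPolyFun f) (hg : IsPolyFun g) : IsPolyFun fun a => f a + g a := by
  obtain ⟨P, hP⟩ := hf
  obtain ⟨Q, hQ⟩ := hg
  exact ⟨P + Q, fun a => by simp [hP, hQ]⟩

lemma mul {f g : ℂ → ℂ} (hf : IsPolyFun f) (hg : IsPolyFun g) : IsPolyFun fun a => f a * g a := by
  obtain ⟨P, hP⟩ := hf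
  obtain ⟨Q, hQ⟩ := hg
  exact ⟨P * Q, fun a => by simp [hP, hQ]⟩

lemma sum {ι : Type*} (s : Finset ι) {f : ι → ℂ → ℂ} (hf : ∀ i ∈ s, IsPolyFun (f i)) :
    IsPolyFun fun a => ∑ i ∈ s, f i a := by
  classical
  induction s using Finset.induction_on with
  | empty => simpa using const 0
  | insert i s hi ih =>
    simp only [Finset.sum_insert hi]
    exact (hf i (by simp)).add (ih fun j hj => hf j (by simp [hj]))

lemma poch {f : ℂ → ℂ} (hf : IsPolyFun f) (n : ℕ) : IsPolyFun fun a => poch (f a) n := by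
  obtain ⟨P, hP⟩ := hf
  exact ⟨(ascPochhammer ℂ n).comp P, fun a => by simp [_root_.poch, hP]⟩

lemma div_const {f : ℂ → ℂ} (hf : IsPolyFun f) (c : ℂ) : IsPolyFun fun a => f a / c := by
  simpa only [div_eq_mul_inv] using hf.mul (const c⁻¹)

/-- A polynomial identity in the parameter may be checked at `-n`, where the power series become
finite binomial expansions. -/
lemma eq_of_neg_natCast {f g : ℂ → ℂ} (hf : IsPolyFun f) (hg : IsPolyFun g)
    (h : ∀ n : ℕ, f (-(n : ℂ)) = g (-(n : ℂ))) (a : ℂ) : f a = g a := by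
  obtain ⟨P, hP⟩ := hf
  obtain ⟨Q, hQ⟩ := hg
  rw [hP, hQ, Polynomial.eq_of_infinite_eval_eq P Q]
  refine (Set.infinite_range_of_injective (f := fun n : ℕ => -(n : ℂ)) ?_).mono ?_
  · intro m n hmn
    simpa using hmn
  · rintro _ ⟨n, rfl⟩
    simpa [hP, hQ] using h n

end IsPolyFun

/-! ### Binomial series and the Gegenbauer expansion at `1` -/

/-- The power series of `(1 - X) ^ (-a)`. -/
noncomputable def negBinomialSeries (a : ℂ) : PowerSeries ℂ :=
  PowerSeries.mk fun n => poch a n / (n.factorial : ℂ)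

section Series

open PowerSeries

lemma coeff_negBinomialSeries (a : ℂ) (n : ℕ) :
    coeff n (negBinomialSeries a) = poch a n / (n.factorial : ℂ) := by
  simp [negBinomialSeries]

lemma negBinomialSeries_eq_rescale (a : ℂ) :
    negBinomialSeries a = rescale (-1) (binomialSeries ℂ (-a)) := by
  ext n
  rw [coeff_negBinomialSeries, coeff_rescale, binomialSeries_coeff, Ring.choose_eq_smul,
    Polynomial.descPochhammer_smeval_eq_ascPochhammer]
  rw [Polynomial.ascPochhammer_smeval_eq_eval, ← poch, show -a - n + 1 = 1 - a - n by ring, poch_reflect]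
  have : ((-1 : ℂ) ^ n) * (-1) ^ n = 1 := by rw [← mul_pow]; simp
  simp only [smul_eq_mul, mul_one]
  rw [← mul_assoc, mul_comm _ ((n.factorial : ℂ)⁻¹), mul_assoc, ← mul_assoc _ _ (poch a n), this]
  field_simp

lemma negBinomialSeries_add (a b : ℂ) :
    negBinomialSeries (a + b) = negBinomialSeries a * negBinomialSeries b := by
  rw [negBinomialSeries_eq_rescale, neg_add, binomialSeries_add, map_mul,
    ← negBinomialSeries_eq_rescale, ← negBinomialSeries_eq_rescale]

lemma negBinomialSeries_zero : negBinomialSeries 0 = 1 := by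
  simp [negBinomialSeries_eq_rescale]

lemma negBinomialSeries_neg_natCast (n : ℕ) : negBinomialSeries (-(n : ℂ)) = (1 - X) ^ n := by
  rw [negBinomialSeries_eq_rescale, neg_neg, binomialSeries_nat]
  simp [rescale_X, sub_eq_add_neg]

lemma natCast_choose_eq_poch (n i : ℕ) :
    (n.choose i : ℂ) = (-1) ^ i * (poch (-(n : ℂ)) i / (i.factorial : ℂ)) := by
  have h1 : (i.factorial : ℂ) ≠ 0 := by exact_mod_cast i.factorial_ne_zero
  have h3 : ((-1 : ℂ) ^ i) * (-1) ^ i = 1 := by rw [← mul_pow]; simp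
  rw [poch_neg_natCast]
  push_cast
  field_simp
  linear_combination -(n.choose i : ℂ) * h3

/-- Writing `n.choose i` through `(-n)_i` and cutting the sum at `k` instead of `n` leaves an
expression polynomial in `-n` when the coefficients of `S i` are, ready for
`IsPolyFun.eq_of_neg_natCast`. -/
lemma coeff_sum_choose (k n : ℕ) (c : ℂ) (S : ℕ → PowerSeries ℂ) :
    coeff k (∑ i ∈ Finset.range (n + 1), C (c ^ i * (n.choose i : ℂ)) * (X ^ i * S i)) =
      ∑ i ∈ Finset.range (k + 1), (-c) ^ i * (poch (-(n : ℂ)) i / (i.factorial : ℂ)) *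
        coeff (k - i) (S i) := by
  have e1 := Finset.sum_subset (s₁ := Finset.range (n + 1))
    (s₂ := Finset.range (max n k + 1)) (f := fun i => if i ≤ k then
      c ^ i * (n.choose i : ℂ) * coeff (k - i) (S i) else 0)
    (by intro i; simp; omega) (fun i _ hi => by
      have : n.choose i = 0 := Nat.choose_eq_zero_of_lt (by simpa using hi)
      simp [this])
  have e2 : (Finset.range (max n k + 1)).filter (· ≤ k) = Finset.range (k + 1) := by
    ext i; simp; omega
  simp only [map_sum, coeff_C_mul, coeff_X_pow_mul', mul_ite, mul_zero]
  rw [e1, ← Finset.sum_filter, e2]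
  refine Finset.sum_congr rfl fun i _ => ?_
  rw [natCast_choose_eq_poch, neg_pow c]
  ring

/-- Expansion of `(1 + X) ^ (-a) * (1 - X) ^ (-b)` via `1 + X = (1 - X) + 2 * X`. -/
lemma coeff_rescale_mul_negBinomialSeries (a b : ℂ) (N : ℕ) :
    coeff N (rescale (-1) (negBinomialSeries a) * negBinomialSeries b) =
      ∑ t ∈ Finset.range (N + 1), (-2) ^ t * (poch a t / (t.factorial : ℂ)) *
        (poch (a + b + t) (N - t) / ((N - t).factorial : ℂ)) := by
  refine IsPolyFun.eq_of_neg_natCast (f := fun a => coeff N (rescale (-1) (negBinomialSeries a) *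
    negBinomialSeries b)) (g := fun a => ∑ t ∈ Finset.range (N + 1),
      (-2) ^ t * (poch a t / (t.factorial : ℂ)) *
        (poch (a + b + t) (N - t) / ((N - t).factorial : ℂ))) ?_ ?_ (fun n => ?_) a
  · simp only [coeff_mul, coeff_rescale, coeff_negBinomialSeries]
    exact .sum _ fun i _ => .mul (.mul (.const _) (.div_const (.poch .id _) _)) (.const _)
  · exact .sum _ fun i _ => .mul (.mul (.const _) (.div_const (.poch .id _) _))
      (.div_const (.poch (.add (.add .id (.const _)) (.const _)) _) _)
  · have key : rescale (-1) (negBinomialSeries (-(n : ℂ))) * negBinomialSeries b =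
        ∑ t ∈ Finset.range (n + 1), C (2 ^ t * (n.choose t : ℂ)) *
          (X ^ t * negBinomialSeries (-(n : ℂ) + b + t)) := by
      rw [negBinomialSeries_neg_natCast, map_pow,
        show rescale (-1 : ℂ) (1 - X) = 2 * X + (1 - X) by simp [rescale_X]; ring, add_pow,
        Finset.sum_mul]
      refine Finset.sum_congr rfl fun t ht => ?_
      have ht' : t ≤ n := by simpa [Nat.lt_succ_iff] using ht
      rw [show -(n : ℂ) + b + t = -((n - t : ℕ) : ℂ) + b by push_cast [ht']; ring,
        negBinomialSeries_add, negBinomialSeries_neg_natCast]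
      simp only [map_mul, map_pow, map_natCast, map_ofNat, mul_pow]
      ring
    rw [key, coeff_sum_choose]
    simp only [coeff_negBinomialSeries]

lemma coeff_X_sub_C_pow (c : ℂ) (l j : ℕ) :
    coeff j ((X - C c) ^ l : PowerSeries ℂ) = (-c) ^ (l - j) * (l.choose j : ℂ) := by
  have : ((X - C c) ^ l : PowerSeries ℂ) =
      (((Polynomial.X + Polynomial.C (-c)) ^ l : Polynomial ℂ) : PowerSeries ℂ) := by
    simp [sub_eq_add_neg]
  rw [this, Polynomial.coeff_coe, Polynomial.coeff_X_add_C_pow]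

/-- Taylor expansion of the Gegenbauer polynomials at `1`. -/
lemma gegenbauerC_eq_sum_sub_one (k : ℕ) (lam x : ℂ) :
    gegenbauerC k lam x = ∑ i ∈ Finset.range (k + 1),
      (2 * (x - 1)) ^ i * (poch lam i / (i.factorial : ℂ)) *
        (poch (2 * lam + 2 * i) (k - i) / ((k - i).factorial : ℂ)) := by
  refine IsPolyFun.eq_of_neg_natCast (f := fun lam => gegenbauerC k lam x)
    (g := fun lam => ∑ i ∈ Finset.range (k + 1),
      (2 * (x - 1)) ^ i * (poch lam i / (i.factorial : ℂ)) *
        (poch (2 * lam + 2 * i) (k - i) / ((k - i).factorial : ℂ))) ?_ ?_ (fun n => ?_) lam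
  · exact .sum _ fun i _ => .mul (.div_const (.mul (.const _) (.poch .id _)) _) (.const _)
  · exact .sum _ fun i _ => .mul (.mul (.const _) (.div_const (.poch .id _) _))
      (.div_const (.poch (.add (.mul (.const _) .id) (.const _)) _) _)
  -- At `λ = -n` the generating function is `(1 - 2xX + X²)^n`. Splitting the base as `(1-X)² -
  -- 2(x-1)X` gives the expansion at `1`; splitting it as `1 + X(X - 2x)` gives the defining sum.
  · have h1 : ((1 - C (2 * x) * X + X ^ 2) ^ n : PowerSeries ℂ) =
        ∑ i ∈ Finset.range (n + 1), C ((-(2 * (x - 1))) ^ i * (n.choose i : ℂ)) *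
          (X ^ i * negBinomialSeries (2 * (-(n : ℂ)) + 2 * i)) := by
      rw [show (1 - C (2 * x) * X + X ^ 2 : PowerSeries ℂ) =
        C (-(2 * (x - 1))) * X + (1 - X) ^ 2 by
          simp only [map_mul, map_neg, map_sub, map_one, map_ofNat]; ring, add_pow]
      refine Finset.sum_congr rfl fun t ht => ?_
      have ht' : t ≤ n := by simpa [Nat.lt_succ_iff] using ht
      rw [show 2 * -(n : ℂ) + 2 * t = -((2 * (n - t) : ℕ) : ℂ) by push_cast [ht']; ring,
        negBinomialSeries_neg_natCast]
      simp only [map_mul, map_pow, map_natCast, mul_pow, ← pow_mul]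
      ring
    have h2 : ((1 - C (2 * x) * X + X ^ 2) ^ n : PowerSeries ℂ) =
        ∑ i ∈ Finset.range (n + 1), C (1 ^ i * (n.choose i : ℂ)) *
          (X ^ i * (X - C (2 * x)) ^ i) := by
      rw [show (1 - C (2 * x) * X + X ^ 2 : PowerSeries ℂ) =
        X * (X - C (2 * x)) + 1 by ring, add_pow]
      refine Finset.sum_congr rfl fun t ht => ?_
      simp only [map_mul, map_natCast, mul_pow, one_pow, map_one]
      ring
    have h3 := congrArg (coeff k) (h2.symm.trans h1)
    rw [coeff_sum_choose, coeff_sum_choose, neg_neg] at h3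
    simp only [coeff_negBinomialSeries, coeff_X_sub_C_pow] at h3
    rw [← h3, ← Finset.sum_range_reflect, gegenbauerC]
    refine Finset.sum_subset_zero_on_sdiff (by intro i; simp; omega) ?_ ?_
    · intro j hj
      simp only [Finset.mem_sdiff, Finset.mem_range] at hj
      rw [Nat.choose_eq_zero_of_lt (by omega)]
      simp
    · intro j hj
      have hj' : 2 * j ≤ k := by simp at hj; omega
      obtain ⟨d, rfl⟩ := Nat.exists_eq_add_of_le hj'
      rw [show 2 * j + d + 1 - 1 - j = j + d by omega, show 2 * j + d - (j + d) = j by omega,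
        show 2 * j + d - 2 * j = d by omega, show 2 * j + d - j = j + d by omega,
        show j + d - j = d by omega]
      have h5 := natCast_add_choose_mul j d
      have f1 : (j.factorial : ℂ) ≠ 0 := by exact_mod_cast j.factorial_ne_zero
      have f2 : (d.factorial : ℂ) ≠ 0 := by exact_mod_cast d.factorial_ne_zero
      have f3 : ((j + d).factorial : ℂ) ≠ 0 := by exact_mod_cast (j + d).factorial_ne_zero
      have h6 : ((-1 : ℂ) ^ d) * (-1) ^ d = 1 := by rw [← mul_pow]; simp
      rw [neg_pow (2 * x), pow_add]
      field_simp
      rw [← h5]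
      linear_combination (-poch (-(n : ℂ)) (j + d) * x ^ d * 2 ^ d *
        (j.factorial : ℂ) * d.factorial * (j + d).choose j) * h6

end Series

/-! ### Generating function of the Mittag-Leffler polynomials -/

section Series

open PowerSeries

/-- The power series of `((1 + X) / (1 - X)) ^ s`. -/
noncomputable def mittagLefflerSeries (s : ℂ) : PowerSeries ℂ :=
  rescale (-1) (negBinomialSeries (-s)) * negBinomialSeries s

lemma mittagLefflerSeries_mul_neg (s : ℂ) :
    mittagLefflerSeries s * mittagLefflerSeries (-s) = 1 := by
  rw [mittagLefflerSeries, mittagLefflerSeries, mul_mul_mul_comm, ← map_mul,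
    ← negBinomialSeries_add, ← negBinomialSeries_add]
  simp [negBinomialSeries_zero]

lemma ordinaryHypergeometric_neg_natCast (n : ℕ) (b c x : ℂ) :
    ordinaryHypergeometric (-(n : ℂ)) b c x = ∑ i ∈ Finset.range (n + 1),
      (i.factorial : ℂ)⁻¹ * poch (-(n : ℂ)) i * poch b i * (poch c i)⁻¹ * x ^ i := by
  rw [ordinaryHypergeometric, ordinaryHypergeometric_sum_eq, tsum_eq_sum (s := Finset.range (n + 1))]
  · rfl
  · intro i hi
    have := poch_neg_natCast n i
    rw [Nat.choose_eq_zero_of_lt (by simpa using hi)] at this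
    rw [poch] at this
    simp [this]

/-- In the expansion of `(1+X)^(-a) (1-X)^(-b)` take `a = -s`, `b = s`. For positive degree the term
`t = 0` contains `(0)_n = 0`, and the shift `t = i + 1` produces the hypergeometric sum, with `(2)_i
= (i+1)!`. -/
lemma coeff_mittagLefflerSeries (n : ℕ) (s : ℂ) :
    coeff n (mittagLefflerSeries s) = mittagLefflerG n s := by
  rw [mittagLefflerSeries, coeff_rescale_mul_negBinomialSeries, mittagLefflerG]
  rcases n with _ | n
  · simp [poch_zero]
  rw [if_neg (by omega), show 1 - ((n + 1 : ℕ) : ℂ) = -(n : ℂ) by push_cast; ring,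
    ordinaryHypergeometric_neg_natCast, Finset.sum_range_succ', Finset.mul_sum]
  have h0 : poch (-s + s + (0 : ℕ)) (n + 1 - 0) = 0 := by
    rw [Nat.sub_zero, poch_succ_left]; simp
  rw [h0, zero_div, mul_zero, add_zero]
  refine Finset.sum_congr rfl fun i hi => ?_
  have hi' : i ≤ n := by simpa [Nat.lt_succ_iff] using hi
  obtain ⟨d, rfl⟩ := Nat.exists_eq_add_of_le hi'
  rw [poch_succ_left, poch_neg_natCast, show i + d + 1 - (i + 1) = d by omega,
    show -s + s + ((i + 1 : ℕ) : ℂ) = (i : ℂ) + 1 by push_cast; ring,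
    show -s + 1 = 1 - s by ring]
  have e1 : poch 2 i = ((i + 1).factorial : ℂ) := by
    have := factorial_mul_poch 1 i
    rw [add_comm i 1, ← this]; norm_num
  have e2 := factorial_mul_poch i d
  have h5 := natCast_add_choose_mul i d
  have f1 : (i.factorial : ℂ) ≠ 0 := by exact_mod_cast i.factorial_ne_zero
  have f2 : (d.factorial : ℂ) ≠ 0 := by exact_mod_cast d.factorial_ne_zero
  have f3 : ((i + 1).factorial : ℂ) ≠ 0 := by exact_mod_cast (i + 1).factorial_ne_zero
  have e3 : poch ((i : ℂ) + 1) d = (i + d).choose i * d.factorial := by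
    apply mul_left_cancel₀ f1
    rw [e2, ← h5]; ring
  rw [e1, e3, pow_succ, neg_pow 2]
  push_cast
  field_simp

/-- The substitution `X ↦ -X` inverts `(1+X)/(1-X)`. -/
lemma mittagLefflerG_neg (n : ℕ) (s : ℂ) :
    mittagLefflerG n (-s) = (-1) ^ n * mittagLefflerG n s := by
  rw [← coeff_mittagLefflerSeries, ← coeff_mittagLefflerSeries, ← coeff_rescale]
  congr 1
  rw [mittagLefflerSeries, mittagLefflerSeries, map_mul, rescale_rescale]
  simp [mul_comm]

lemma sum_mittagLefflerG_mul_neg (N : ℕ) (s : ℂ) :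
    ∑ p ∈ Finset.range (N + 1), mittagLefflerG p s * mittagLefflerG (N - p) (-s) =
      if N = 0 then 1 else 0 := by
  have := congrArg (coeff N) (mittagLefflerSeries_mul_neg s)
  rw [coeff_mul, Finset.Nat.sum_antidiagonal_eq_sum_range_succ_mk, coeff_one] at this
  simpa only [coeff_mittagLefflerSeries] using this

/-- Coefficients of `((1+X)/(1-X))^s (1-X)^(2s-r) = (1+X)^s (1-X)^(s-r)`, the right side being
expanded after `X ↦ -X`. -/
lemma sum_mittagLefflerG_mul_poch (N : ℕ) (s r : ℂ) :
    ∑ p ∈ Finset.range (N + 1), mittagLefflerG p s *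
        (poch (r - 2 * s) (N - p) / ((N - p).factorial : ℂ)) =
      (-1) ^ N * ∑ t ∈ Finset.range (N + 1), (-2) ^ t * (poch (r - s) t / (t.factorial : ℂ)) *
        (poch (r - 2 * s + t) (N - t) / ((N - t).factorial : ℂ)) := by
  have h : mittagLefflerSeries s * negBinomialSeries (r - 2 * s) =
      rescale (-1) (rescale (-1) (negBinomialSeries (r - s)) * negBinomialSeries (-s)) := by
    rw [map_mul, rescale_rescale, mittagLefflerSeries, mul_assoc, ← negBinomialSeries_add,
      show s + (r - 2 * s) = r - s by ring]
    simp [mul_comm]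
  have := congrArg (coeff N) h
  rw [coeff_rescale, coeff_rescale_mul_negBinomialSeries, coeff_mul,
    Finset.Nat.sum_antidiagonal_eq_sum_range_succ_mk, show r - s + -s = r - 2 * s by ring] at this
  simpa only [coeff_mittagLefflerSeries, coeff_negBinomialSeries] using this

end Series

/-! ### Comparison of coefficients and the two expansions -/

/-- The coefficient of `w ^ s` in `C_k^τ(x) / (2 (x - 1))^k`, where `w = 1 / (2 (x - 1))`. -/
noncomputable def normCoeff (k : ℕ) (tau : ℂ) (s : ℕ) : ℂ :=
  poch tau (k - s) / ((k - s).factorial : ℂ) *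
    (poch (2 * tau + 2 * ((k - s : ℕ) : ℂ)) s / (s.factorial : ℂ))

lemma normC_eq_sum (k : ℕ) (tau : ℂ) {x : ℂ} (hx : x ≠ 1) :
    normC k tau x = ∑ s ∈ Finset.range (k + 1), normCoeff k tau s * (1 / (2 * (x - 1))) ^ s := by
  have hx' : x - 1 ≠ 0 := sub_ne_zero.mpr hx
  rw [normC, gegenbauerC_eq_sum_sub_one, ← Finset.sum_range_reflect, Finset.sum_div]
  refine Finset.sum_congr rfl fun s hs => ?_
  have hs' : s ≤ k := by simpa [Nat.lt_succ_iff] using hs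
  obtain ⟨d, rfl⟩ := Nat.exists_eq_add_of_le hs'
  rw [normCoeff, show s + d + 1 - 1 - s = d by omega, show s + d - s = d by omega,
    show s + d - d = s by omega, ← mul_pow, pow_add, one_div, inv_pow]
  field_simp

lemma normCRecip_eq_normC_inv (k : ℕ) (tau x : ℂ) :
    normCRecip k tau x = (-1) ^ k * normC k tau (1 / x) := by
  rw [normCRecip, normC, show 1 - 1 / x = (-1) * (1 / x - 1) by ring, mul_pow]
  rcases neg_one_pow_eq_or ℂ k with h | h <;> rw [h] <;> ring

lemma normCRecip_eq_sum (k : ℕ) (tau : ℂ) {x : ℂ} (h0 : x ≠ 0) (hx : x ≠ 1) :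
    normCRecip k tau x = (-1) ^ k * ∑ s ∈ Finset.range (k + 1),
      normCoeff k tau s * (-(1 / (2 * (x - 1)) + 1 / 2)) ^ s := by
  have hx' : x - 1 ≠ 0 := sub_ne_zero.mpr hx
  have h1 : 1 / x ≠ 1 := by
    intro h
    rw [div_eq_iff h0] at h
    exact hx (by simpa using h.symm)
  rw [normCRecip_eq_normC_inv, normC_eq_sum k tau h1,
    show 1 / (2 * (1 / x - 1)) = -(1 / (2 * (x - 1)) + 1 / 2) by
      have : 1 / x - 1 ≠ 0 := sub_ne_zero.mpr h1
      rw [show 1 / x - 1 = -(x - 1) / x by field_simp; ring]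
      field_simp
      ring]

/-- Split `(2λ+2n)_{r+2t}` after `r+t` factors and after `2t` factors, and apply duplication to
`(2(λ+n))_{2t}`. -/
lemma poch_mul_duplication (lam : ℂ) (r n t : ℕ) :
    poch lam n * poch (2 * lam + 2 * n) (r + t) * poch (((r + (n + t) : ℕ) : ℂ) + 2 * lam) (n + t) =
      poch lam (n + t) * poch (2 * lam + 2 * ((n + t : ℕ) : ℂ)) r * 4 ^ t *
        poch (lam + n + 1 / 2) t * poch (((r + (n + t) : ℕ) : ℂ) + 2 * lam) n := by
  have h1 := poch_add (2 * lam + 2 * n) (r + t) t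
  have h2 := poch_add (2 * (lam + n)) (2 * t) r
  rw [poch_two_mul] at h2
  rw [show r + t + t = 2 * t + r by ring, show 2 * lam + 2 * (n : ℂ) = 2 * (lam + n) by ring, h2]
    at h1
  rw [poch_add _ n t, poch_add lam n t, show 2 * lam + 2 * (n : ℂ) = 2 * (lam + n) by ring,
    show ((r + (n + t) : ℕ) : ℂ) + 2 * lam + n = 2 * (lam + n) + (r + t : ℕ) by push_cast; ring,
    show 2 * lam + 2 * ((n + t : ℕ) : ℂ) = 2 * (lam + n) + (2 * t : ℕ) by push_cast; ring]
  linear_combination -(poch lam n * poch (((r + (n + t) : ℕ) : ℂ) + 2 * lam) n) * h1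

lemma sum_normCoeff_eq (r N : ℕ) (lam : ℂ) (hne : poch (((r + N : ℕ) : ℂ) + 2 * lam) N ≠ 0) :
    ∑ t ∈ Finset.range (N + 1), normCoeff (r + N) lam (r + t) * (-1) ^ (r + t) *
        ((r + t).choose r : ℂ) * (1 / 2) ^ t =
      ∑ p ∈ Finset.range (N + 1), coeffFwd (r + N) (r + N - p) lam * (-1) ^ (r + N - p) *
        normCoeff (r + N - p) ((p : ℂ) + lam) r := by
  -- With `k = r + N` and `s = k + λ - 1/2`, one has `r - 2s = 1 - (k + 2λ) - N`, so reflection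
  -- applies. Up to the common factor `(-1)^r * A`, the two sides of the goal are the two sides of
  -- `key`.
  have key := sum_mittagLefflerG_mul_poch N (((r + N : ℕ) : ℂ) + lam - 1 / 2) (r : ℂ)
  set P := poch (((r + N : ℕ) : ℂ) + 2 * lam) N with hP
  set A := poch lam N * poch (2 * lam + 2 * (N : ℂ)) r / (r.factorial : ℂ) / P with hA
  have fr : (r.factorial : ℂ) ≠ 0 := by exact_mod_cast r.factorial_ne_zero
  trans (-1) ^ r * A * ((-1) ^ N * ∑ t ∈ Finset.range (N + 1), (-2) ^ t *
      (poch ((r : ℂ) - (((r + N : ℕ) : ℂ) + lam - 1 / 2)) t / (t.factorial : ℂ)) *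
        (poch ((r : ℂ) - 2 * (((r + N : ℕ) : ℂ) + lam - 1 / 2) + t) (N - t) /
          ((N - t).factorial : ℂ)))
  · rw [Finset.mul_sum, Finset.mul_sum]
    refine Finset.sum_congr rfl fun t ht => ?_
    have ht' : t ≤ N := by simpa [Nat.lt_succ_iff] using ht
    obtain ⟨n, rfl⟩ := Nat.exists_eq_add_of_le' ht'
    have dup := poch_mul_duplication lam r n t
    rw [← hP] at dup
    have r1 := poch_reflect (lam + n + 1 / 2) t
    have r2 := poch_reflect (((r + (n + t) : ℕ) : ℂ) + 2 * lam) n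
    have hc := natCast_add_choose_mul r t
    have ft : (t.factorial : ℂ) ≠ 0 := by exact_mod_cast t.factorial_ne_zero
    have fn : (n.factorial : ℂ) ≠ 0 := by exact_mod_cast n.factorial_ne_zero
    have frt : ((r + t).factorial : ℂ) ≠ 0 := by exact_mod_cast (r + t).factorial_ne_zero
    have hc' : ((r + t).choose r : ℂ) = (r + t).factorial / (r.factorial * t.factorial) := by
      rw [eq_div_iff (mul_ne_zero fr ft), ← hc]; ring
    rw [show (r : ℂ) - (((r + (n + t) : ℕ) : ℂ) + lam - 1 / 2) = 1 - (lam + n + 1 / 2) - t by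
        push_cast; ring, show n + t - t = n by omega,
      show (r : ℂ) - 2 * (((r + (n + t) : ℕ) : ℂ) + lam - 1 / 2) + t =
        1 - (((r + (n + t) : ℕ) : ℂ) + 2 * lam) - n by push_cast; ring, r1, r2, normCoeff,
      show r + (n + t) - (r + t) = n by omega, hc']
    have dup' : poch lam n * poch (2 * lam + 2 * (n : ℂ)) (r + t) =
      poch lam (n + t) * poch (2 * lam + 2 * ((n + t : ℕ) : ℂ)) r * 4 ^ t *
        poch (lam + n + 1 / 2) t * poch (((r + (n + t) : ℕ) : ℂ) + 2 * lam) n / P := by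
      rw [eq_div_iff hne, dup]
    rw [hA]
    trans poch lam n * poch (2 * lam + 2 * (n : ℂ)) (r + t) * ((-1) ^ (r + t) * (1 / 2) ^ t /
        (r.factorial * t.factorial * n.factorial))
    · field_simp
    · rw [dup', show (4 : ℂ) ^ t = 2 ^ t * 2 ^ t by rw [← mul_pow]; norm_num, neg_pow 2, pow_add,
        pow_add, one_div, inv_pow]
      field_simp
      rcases neg_one_pow_eq_or ℂ n with h | h <;>
        rcases neg_one_pow_eq_or ℂ t with h' | h' <;> rw [h, h'] <;> ring
  · rw [← key, Finset.mul_sum]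
    refine Finset.sum_congr rfl fun p hp => ?_
    have hp' : p ≤ N := by simpa [Nat.lt_succ_iff] using hp
    obtain ⟨n, rfl⟩ := Nat.exists_eq_add_of_le hp'
    have r1 := poch_reflect (((r + (p + n) : ℕ) : ℂ) + 2 * lam + p) n
    have hPs : P = _ := poch_add (((r + (p + n) : ℕ) : ℂ) + 2 * lam) p n
    have hls := poch_add lam p n
    have fn : (n.factorial : ℂ) ≠ 0 := by exact_mod_cast n.factorial_ne_zero
    rw [show (r : ℂ) - 2 * (((r + (p + n) : ℕ) : ℂ) + lam - 1 / 2) =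
        1 - (((r + (p + n) : ℕ) : ℂ) + 2 * lam + p) - n by push_cast; ring,
      show p + n - p = n by omega, r1, normCoeff, coeffFwd,
      show r + (p + n) - p = r + n by omega, show r + (p + n) - (r + n) = p by omega,
      show r + n - r = n by omega, hA, hls, add_comm (p : ℂ) lam,
      show 2 * (lam + p) + 2 * (n : ℂ) = 2 * lam + 2 * ((p + n : ℕ) : ℂ) by push_cast; ring]
    rw [hPs] at hne ⊢
    have n1 := left_ne_zero_of_mul hne
    have n2 := right_ne_zero_of_mul hne
    rw [pow_add]
    generalize poch (((r + (p + n) : ℕ) : ℂ) + 2 * lam + p) n = u at *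
    generalize poch (((r + (p + n) : ℕ) : ℂ) + 2 * lam) p = v at *
    field_simp

lemma sum_range_triangle_comm (k : ℕ) (f : ℕ → ℕ → ℂ) :
    ∑ p ∈ Finset.range (k + 1), ∑ r ∈ Finset.range (k - p + 1), f p r =
      ∑ r ∈ Finset.range (k + 1), ∑ p ∈ Finset.range (k - r + 1), f p r :=
  Finset.sum_comm' fun p r => by simp only [Finset.mem_range]; omega

lemma sum_normCoeff_mul_pow (k : ℕ) (lam v : ℂ) (h : ∀ j < k, (k : ℂ) + 2 * lam + j ≠ 0) :
    ∑ s ∈ Finset.range (k + 1), normCoeff k lam s * (-(v + 1 / 2)) ^ s =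
      ∑ m ∈ Finset.range (k + 1), coeffFwd k m lam * ((-1) ^ m *
        ∑ s ∈ Finset.range (m + 1), normCoeff m (((k - m : ℕ) : ℂ) + lam) s * v ^ s) := by
  trans ∑ p ∈ Finset.range (k + 1), ∑ r ∈ Finset.range (k - p + 1),
      normCoeff k lam (k - p) * (-1) ^ (k - p) * ((k - p).choose r : ℂ) * (1 / 2) ^ (k - p - r) *
        v ^ r
  · rw [← Finset.sum_range_reflect]
    refine Finset.sum_congr rfl fun p _ => ?_
    rw [Nat.add_sub_cancel, neg_pow, add_pow, Finset.mul_sum, Finset.mul_sum]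
    refine Finset.sum_congr rfl fun r _ => ?_
    ring
  trans ∑ p ∈ Finset.range (k + 1), ∑ r ∈ Finset.range (k - p + 1),
      coeffFwd k (k - p) lam * (-1) ^ (k - p) * normCoeff (k - p) ((p : ℂ) + lam) r * v ^ r
  swap
  · rw [← Finset.sum_range_reflect _ (k + 1)]
    refine Finset.sum_congr rfl fun p hp => ?_
    have hp' : p ≤ k := by simpa [Nat.lt_succ_iff] using hp
    rw [Nat.add_sub_cancel, Nat.sub_sub_self hp', Finset.mul_sum, Finset.mul_sum]
    refine Finset.sum_congr rfl fun r _ => ?_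
    ring
  rw [sum_range_triangle_comm]
  conv_rhs => rw [sum_range_triangle_comm]
  refine Finset.sum_congr rfl fun r hr => ?_
  have hr' : r ≤ k := by simpa [Nat.lt_succ_iff] using hr
  obtain ⟨N, rfl⟩ := Nat.exists_eq_add_of_le hr'
  rw [← Finset.sum_mul, ← Finset.sum_mul, show r + N - r = N by omega, ← sum_normCoeff_eq,
    ← Finset.sum_range_reflect]
  · congr 1
    refine Finset.sum_congr rfl fun t ht => ?_
    have ht' : t ≤ N := by simpa [Nat.lt_succ_iff] using ht
    rw [show r + N - (N + 1 - 1 - t) = r + t by omega, show r + t - r = t by omega]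
  · exact poch_ne_zero fun j hj => h j (by omega)

lemma normC_eq_sum_coeffFwd (k : ℕ) (lam : ℂ) (h : ∀ j < k, (k : ℂ) + 2 * lam + j ≠ 0)
    {x : ℂ} (h0 : x ≠ 0) (h1 : x ≠ 1) :
    normC k lam x = ∑ m ∈ Finset.range (k + 1),
      coeffFwd k m lam * normCRecip m (((k - m : ℕ) : ℂ) + lam) x := by
  -- The point `-(w + 1/2)` is used because the involution sends it back to `w`.
  have := sum_normCoeff_mul_pow k lam (-(1 / (2 * (x - 1)) + 1 / 2)) h
  simp only [normC_eq_sum _ _ h1, normCRecip_eq_sum _ _ h0 h1]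
  rw [← this, show -(-(1 / (2 * (x - 1)) + 1 / 2) + 1 / 2) = 1 / (2 * (x - 1)) by ring]

lemma coeffBwd_eq (k m : ℕ) (hm : m ≤ k) (lam : ℂ) :
    coeffBwd k m lam = (-1) ^ k * (-1) ^ m * coeffFwd k m lam := by
  obtain ⟨p, rfl⟩ := Nat.exists_eq_add_of_le hm
  have h3 : ((-1 : ℂ) ^ m) * (-1) ^ m = 1 := by rw [← mul_pow]; simp
  rw [coeffBwd, coeffFwd, show 1 / 2 - ((m + p : ℕ) : ℂ) - lam =
    -(((m + p : ℕ) : ℂ) + lam - 1 / 2) by ring, mittagLefflerG_neg, Nat.add_sub_cancel_left,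
    pow_add, mul_right_comm ((-1) ^ m), h3]
  ring

lemma normCRecip_eq_sum_coeffBwd (k : ℕ) (lam : ℂ) (h : ∀ j < k, (k : ℂ) + 2 * lam + j ≠ 0)
    {x : ℂ} (h0 : x ≠ 0) (h1 : x ≠ 1) :
    normCRecip k lam x = ∑ m ∈ Finset.range (k + 1),
      coeffBwd k m lam * normC m (((k - m : ℕ) : ℂ) + lam) x := by
  simp only [normC_eq_sum _ _ h1, normCRecip_eq_sum _ _ h0 h1]
  rw [sum_normCoeff_mul_pow k lam _ h, Finset.mul_sum]
  refine Finset.sum_congr rfl fun m hm => ?_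
  rw [coeffBwd_eq k m (by simpa [Nat.lt_succ_iff] using hm)]
  ring

/-! ### Inverse relations -/

lemma mul_div_poch_mul (a b lam : ℂ) (n p q : ℕ) :
    a * poch lam p / poch (((n + (p + q) : ℕ) : ℂ) + 2 * lam) p *
      (b * poch ((p : ℂ) + lam) q / poch (((n + q : ℕ) : ℂ) + 2 * ((p : ℂ) + lam)) q) =
    a * b * (poch lam (p + q) / poch (((n + (p + q) : ℕ) : ℂ) + 2 * lam) (p + q)) := by
  rw [poch_add, poch_add, add_comm (p : ℂ) lam,
    show ((n + q : ℕ) : ℂ) + 2 * (lam + p) = ((n + (p + q) : ℕ) : ℂ) + 2 * lam + p by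
      push_cast; ring]
  simp only [div_eq_mul_inv, mul_inv]
  ring

lemma coeffFwd_mul_coeffBwd (n p q : ℕ) (lam : ℂ) :
    coeffFwd (n + (p + q)) (n + q) lam * coeffBwd (n + q) n ((p : ℂ) + lam) =
      mittagLefflerG p (((n + (p + q) : ℕ) : ℂ) + lam - 1 / 2) *
        mittagLefflerG q (-(((n + (p + q) : ℕ) : ℂ) + lam - 1 / 2)) *
        (poch lam (p + q) / poch (((n + (p + q) : ℕ) : ℂ) + 2 * lam) (p + q)) := by
  rw [coeffFwd, coeffBwd, show n + (p + q) - (n + q) = p by omega, Nat.add_sub_cancel_left,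
    mul_div_poch_mul]
  congr 3
  push_cast; ring

lemma coeffBwd_mul_coeffFwd (n p q : ℕ) (lam : ℂ) :
    coeffBwd (n + (p + q)) (n + q) lam * coeffFwd (n + q) n ((p : ℂ) + lam) =
      mittagLefflerG p (-(((n + (p + q) : ℕ) : ℂ) + lam - 1 / 2)) *
        mittagLefflerG q (- -(((n + (p + q) : ℕ) : ℂ) + lam - 1 / 2)) *
        (poch lam (p + q) / poch (((n + (p + q) : ℕ) : ℂ) + 2 * lam) (p + q)) := by
  rw [coeffFwd, coeffBwd, show n + (p + q) - (n + q) = p by omega, Nat.add_sub_cancel_left,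
    mul_div_poch_mul]
  congr 3 <;> (push_cast; ring)

/-- The Pochhammer quotient depends only on `p + q = k - n`, so it factors out of the convolution.
No nonvanishing is needed: for `n < k` the convolution is zero, and for `n = k` the quotient is `1`.
-/
lemma sum_Icc_eq_ite {n k : ℕ} (hn : n ≤ k) (lam s : ℂ) (F : ℕ → ℂ)
    (hF : ∀ p q, p + q = k - n → F (n + q) = mittagLefflerG p s * mittagLefflerG q (-s) *
      (poch lam (p + q) / poch ((k : ℂ) + 2 * lam) (p + q))) :
    ∑ m ∈ Finset.Icc n k, F m = if n = k then 1 else 0 := by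
  obtain ⟨N, rfl⟩ := Nat.exists_eq_add_of_le hn
  rw [← Finset.Ico_add_one_right_eq_Icc, Finset.sum_Ico_eq_sum_range,
    show n + N + 1 - n = N + 1 by omega, ← Finset.sum_range_reflect]
  trans (∑ p ∈ Finset.range (N + 1), mittagLefflerG p s * mittagLefflerG (N - p) (-s)) *
      (poch lam N / poch (((n + N : ℕ) : ℂ) + 2 * lam) N)
  · rw [Finset.sum_mul]
    refine Finset.sum_congr rfl fun p hp => ?_
    have hp' : p ≤ N := by simpa [Nat.lt_succ_iff] using hp
    have := hF p (N - p) (by omega)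
    rw [Nat.add_sub_of_le hp'] at this
    rw [Nat.add_sub_cancel, this]
  · rw [sum_mittagLefflerG_mul_neg]
    rcases N with _ | N
    · simp [poch_zero]
    · simp

lemma sum_coeffFwd_mul_coeffBwd {n k : ℕ} (hn : n ≤ k) (lam : ℂ) :
    ∑ m ∈ Finset.Icc n k, coeffFwd k m lam * coeffBwd m n (((k - m : ℕ) : ℂ) + lam) =
      if n = k then 1 else 0 := by
  refine sum_Icc_eq_ite hn lam ((k : ℂ) + lam - 1 / 2) _ fun p q hpq => ?_
  obtain rfl : k = n + (p + q) := by omega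
  rw [show n + (p + q) - (n + q) = p by omega, coeffFwd_mul_coeffBwd]

lemma sum_coeffBwd_mul_coeffFwd {n k : ℕ} (hn : n ≤ k) (lam : ℂ) :
    ∑ m ∈ Finset.Icc n k, coeffBwd k m lam * coeffFwd m n (((k - m : ℕ) : ℂ) + lam) =
      if n = k then 1 else 0 := by
  refine sum_Icc_eq_ite hn lam (-((k : ℂ) + lam - 1 / 2)) _ fun p q hpq => ?_
  obtain rfl : k = n + (p + q) := by omega
  rw [show n + (p + q) - (n + q) = p by omega, coeffBwd_mul_coeffFwd]

/-! ### Limits at the excluded parameters -/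

lemma continuous_gegenbauerC (k : ℕ) (x : ℂ) : Continuous fun tau => gegenbauerC k tau x := by
  have := continuous_poch
  unfold gegenbauerC
  fun_prop

lemma eventually_add_ne_zero (k : ℕ) (lam : ℂ) :
    ∀ᶠ z in 𝓝[≠] lam, ∀ j < k, (k : ℂ) + 2 * z + j ≠ 0 := by
  simp only [← Finset.mem_range]
  rw [Filter.eventually_all_finset]
  intro j _
  have hz : ∀ z : ℂ, z ≠ -((k : ℂ) + j) / 2 → (k : ℂ) + 2 * z + j ≠ 0 := fun z hz h =>
    hz (by linear_combination h / 2)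
  -- The only zero in `z` is either `lam` itself, removed by the puncture, or lies away from `lam`.
  rcases eq_or_ne lam (-((k : ℂ) + j) / 2) with h | h
  · filter_upwards [self_mem_nhdsWithin] with z hzl
    exact hz z (h ▸ hzl)
  · filter_upwards [nhdsWithin_le_nhds (isOpen_ne.mem_nhds h)] with z hzl
    exact hz z hzl

theorem mainTheorem12 (k : ℕ) (lam : ℂ) :
    -- the two sums, at every parameter for which no denominator `(k+2λ)_{k-m}` vanishes,
    -- together with the fact that they are inverse to each other
    ((∀ j : ℕ, j < k → (k : ℂ) + 2 * lam + (j : ℂ) ≠ 0) →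
      (∀ x : ℂ, x ≠ 0 → x ≠ 1 →
        normC k lam x =
            ∑ m ∈ Finset.range (k + 1),
              coeffFwd k m lam * normCRecip m (((k - m : ℕ) : ℂ) + lam) x ∧
        normCRecip k lam x =
            ∑ m ∈ Finset.range (k + 1),
              coeffBwd k m lam * normC m (((k - m : ℕ) : ℂ) + lam) x) ∧
      (∀ n : ℕ, n ≤ k →
        ∑ m ∈ Finset.Icc n k,
            coeffFwd k m lam * coeffBwd m n (((k - m : ℕ) : ℂ) + lam) =
          (if n = k then 1 else 0) ∧
        ∑ m ∈ Finset.Icc n k,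
            coeffBwd k m lam * coeffFwd m n (((k - m : ℕ) : ℂ) + lam) =
          (if n = k then 1 else 0))) ∧
    -- at the remaining parameters the sums are read as limits
    (∀ x : ℂ, x ≠ 0 → x ≠ 1 →
      Tendsto (fun z : ℂ => ∑ m ∈ Finset.range (k + 1),
          coeffFwd k m z * normCRecip m (((k - m : ℕ) : ℂ) + z) x)
        (𝓝[≠] lam) (𝓝 (normC k lam x)) ∧
      Tendsto (fun z : ℂ => ∑ m ∈ Finset.range (k + 1),
          coeffBwd k m z * normC m (((k - m : ℕ) : ℂ) + z) x)
        (𝓝[≠] lam) (𝓝 (normCRecip k lam x))) := by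
  refine ⟨fun h => ⟨fun x h0 h1 => ⟨normC_eq_sum_coeffFwd k lam h h0 h1,
    normCRecip_eq_sum_coeffBwd k lam h h0 h1⟩, fun n hn => ⟨sum_coeffFwd_mul_coeffBwd hn lam,
    sum_coeffBwd_mul_coeffFwd hn lam⟩⟩, fun x h0 h1 => ⟨?_, ?_⟩⟩
  · have hc : Continuous fun z => normC k z x := (continuous_gegenbauerC k x).div_const _
    refine ((hc.tendsto lam).mono_left nhdsWithin_le_nhds).congr' ?_
    filter_upwards [eventually_add_ne_zero k lam] with z hz
    exact normC_eq_sum_coeffFwd k z hz h0 h1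
  · have hc : Continuous fun z => normCRecip k z x :=
      (continuous_gegenbauerC k (1 / x)).div_const _
    refine ((hc.tendsto lam).mono_left nhdsWithin_le_nhds).congr' ?_
    filter_upwards [eventually_add_ne_zero k lam] with z hz
    exact normCRecip_eq_sum_coeffBwd k z hz h0 h1
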